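/- Let $n\ge 1$ be an integer and let $f\colon\mathbb R^{n+1}\to\mathbb C$ be a Schwartz function that is even in the last variable, i.e. $f(x,-y)=f(x,y)$ for all $x\in\mathbb R^n$, $y\in\mathbb R$. Let $S^n$ be the unit sphere of $\mathbb R^{n+1}$ with its surface measure $S_n$ and put $$Rf(x,r)=\frac1{|S^n|}\int_{S^n} f(x+r\xi,r\eta)\,dS_n(\xi,\eta)\qquad(x\in\mathbb R^n,\ r\ge 0),$$ where $(\xi,\eta)\in\mathbb R^n\times\mathbb R$. Regard $g=Rf$ as the bounded measurable function $g(x,y)=Rf(x,\|y\|)$ on $\mathbb R^n\times\mathbb R^{n+1}$, and hence as a tempered distribution. Let $\hat g$ be its Fourier transform as a tempered distribution, $\langle\hat g,\varphi\rangle=\langle g,\hat\varphi\rangle$, where $\hat\varphi(\zeta)=(2\pi)^{-(2n+1)/2}\int_{\mathbb R^{n}\times\mathbb R^{n+1}}e^{-i\langle z,\zeta\rangle}\varphi(z)\,dz$ for Schwartz functions $\varphi$. Then $\hat g\in L^1(\mathbb R^n\times\mathbb R^{n+1})$, that is, the distribution $\hat g$ is given by an integrable function. Moreover $\eta\hat g\in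 L^1$: writing $(\xi,\eta)$ for the variables in $\mathbb R^n\times\mathbb R^{n+1}$, for every coordinate $\eta_j$ ($1\le j\le n+1$) of $\eta$ the distribution $\eta_j\hat g$ is given by an integrable function. -/

import Mathlib

open MeasureTheory SchwartzMap FourierTransform
open scoped ENNReal RealInnerProductSpace

noncomputable section

namespace SphericalRadon

section FourierConvention

variable {V : Type*} [NormedAddCommGroup V] [InnerProductSpace ℝ V] [FiniteDimensional ℝ V]
  [MeasurableSpace V] [BorelSpace V]

/-- The factor `(2π)⁻¹` is a nonzero real number. -/
lemma two_pi_inv_ne_zero : ((2 * Real.pi)⁻¹ : ℝ) ≠ 0 := inv_ne_zero Real.two_pi_pos.ne'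

variable (V) in
/-- The dilation `ξ ↦ ξ / (2π)` of `V`. -/
def dilation : V ≃L[ℝ] V :=
  ContinuousLinearEquiv.smulLeft (Units.mk0 ((2 * Real.pi)⁻¹ : ℝ) two_pi_inv_ne_zero)

variable (V) in
/-- The Fourier transform of Schwartz functions on the `d`-dimensional Euclidean space `V`, in the
unitary convention with angular frequency:
`φ̂(ξ) = (2π)^(-d/2) ∫ exp(-i⟨x, ξ⟩) φ(x) dx` (see `schwartzFourier_apply`). -/
def schwartzFourier : 𝓢(V, ℂ) →L[ℂ] 𝓢(V, ℂ) :=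
  (((2 * Real.pi) ^ (-(Module.finrank ℝ V : ℝ) / 2) : ℝ) : ℂ) •
    ((SchwartzMap.compCLMOfContinuousLinearEquiv ℂ (dilation V)).comp
      (fourierCLM ℂ 𝓢(V, ℂ)))

/-- The integral formula for the Fourier transform `schwartzFourier`. -/
theorem schwartzFourier_apply (φ : 𝓢(V, ℂ)) (ξ : V) :
    schwartzFourier V φ ξ =
      (((2 * Real.pi) ^ (-(Module.finrank ℝ V : ℝ) / 2) : ℝ) : ℂ) *
        ∫ x : V, Complex.exp (-(Complex.I * (⟪x, ξ⟫ : ℝ))) * φ x := by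
  have h : schwartzFourier V φ ξ =
      (((2 * Real.pi) ^ (-(Module.finrank ℝ V : ℝ) / 2) : ℝ) : ℂ) *
        (𝓕 (φ : V → ℂ)) ((2 * Real.pi)⁻¹ • ξ) := rfl
  rw [h, Real.fourier_eq']
  congr 1
  refine integral_congr_ae (Filter.Eventually.of_forall fun x => ?_)
  simp only [smul_eq_mul, inner_smul_right]
  congr 2
  have : (-2 * Real.pi * ((2 * Real.pi)⁻¹ * ⟪x, ξ⟫) : ℝ) = -⟪x, ξ⟫ := by
    have := Real.pi_pos.ne'
    field_simp
  rw [this]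
  push_cast
  ring

/-- The Fourier transform of a tempered distribution `T`: `⟨T̂, φ⟩ = ⟨T, φ̂⟩`. -/
def distFourier (T : 𝓢'(V, ℂ)) : 𝓢'(V, ℂ) :=
  PointwiseConvergenceCLM.precomp ℂ (schwartzFourier V) T

theorem distFourier_apply (T : 𝓢'(V, ℂ)) (φ : 𝓢(V, ℂ)) :
    distFourier T φ = T (schwartzFourier V φ) := rfl

/-- A tempered distribution `T` belongs to `L¹`: there is an integrable function `h` with
`⟨T, φ⟩ = ∫ φ h` for all Schwartz functions `φ`. -/
def IsL1 (T : 𝓢'(V, ℂ)) : Prop :=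
  ∃ h : Lp ℂ 1 (volume : Measure V), Lp.toTemperedDistribution h = T

end FourierConvention

/-- The point `(x, y) ∈ ℝⁿ⁺¹` for `x ∈ ℝⁿ`, `y ∈ ℝ`. -/
def joinLast {n : ℕ} (x : EuclideanSpace ℝ (Fin n)) (y : ℝ) : EuclideanSpace ℝ (Fin (n + 1)) :=
  WithLp.toLp 2 (Fin.snoc (α := fun _ => ℝ) (fun i => x i) y)

/-- The first `n` coordinates of a point of `ℝⁿ⁺¹`. -/
def firstCoords {n : ℕ} (ω : EuclideanSpace ℝ (Fin (n + 1))) : EuclideanSpace ℝ (Fin n) :=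
  WithLp.toLp 2 (fun i => ω i.castSucc)

/-- `φ : ℝⁿ⁺¹ → ℂ` is even in the last variable. -/
def EvenInLast {n : ℕ} (φ : EuclideanSpace ℝ (Fin (n + 1)) → ℂ) : Prop :=
  ∀ (x : EuclideanSpace ℝ (Fin n)) (y : ℝ), φ (joinLast x (-y)) = φ (joinLast x y)

/-- The spherical Radon transform: `Rf(x, r)` is the mean value of `f(x + rξ, rη)` over the points
`(ξ, η)` of the unit sphere of `ℝⁿ⁺¹`, with respect to the surface measure. -/
def sphericalRadon {n : ℕ} (f : EuclideanSpace ℝ (Fin (n + 1)) → ℂ)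
    (x : EuclideanSpace ℝ (Fin n)) (r : ℝ) : ℂ :=
  ⨍ ω : Metric.sphere (0 : EuclideanSpace ℝ (Fin (n + 1))) 1,
    f (joinLast (x + r • firstCoords ω.1) (r * ω.1 (Fin.last n)))
      ∂(volume : Measure (EuclideanSpace ℝ (Fin (n + 1)))).toSphere

theorem joinLast_add_smul {n : ℕ} (x : EuclideanSpace ℝ (Fin n)) (r : ℝ)
    (ω : EuclideanSpace ℝ (Fin (n + 1))) :
    joinLast (x + r • firstCoords ω) (r * ω (Fin.last n)) = joinLast x 0 + r • ω := by
  ext i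
  refine Fin.lastCases ?_ (fun j => ?_) i <;> simp [joinLast, firstCoords]

theorem continuous_joinLast_zero {n : ℕ} :
    Continuous fun x : EuclideanSpace ℝ (Fin n) => joinLast x 0 := by
  refine (PiLp.continuous_toLp 2 _).comp (continuous_pi fun i => ?_)
  refine Fin.lastCases ?_ (fun j => ?_) i
  · simpa using continuous_const
  · simp only [Fin.snoc_castSucc]
    fun_prop

/-- The Euclidean space `ℝⁿ × ℝⁿ⁺¹`. -/
abbrev DataSpace (n : ℕ) : Type :=
  WithLp 2 (EuclideanSpace ℝ (Fin n) × EuclideanSpace ℝ (Fin (n + 1)))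

/-- `g = Rf` as a function on `ℝⁿ × ℝⁿ⁺¹`, radial in the second variable: `g(x, y) = Rf(x, ‖y‖)`. -/
def dataFun {n : ℕ} (f : EuclideanSpace ℝ (Fin (n + 1)) → ℂ) (p : DataSpace n) : ℂ :=
  sphericalRadon f p.fst ‖p.snd‖

/-- For a Schwartz function `f`, the function `g = Rf` is measurable and bounded. -/
theorem memLp_dataFun {n : ℕ} (f : 𝓢(EuclideanSpace ℝ (Fin (n + 1)), ℂ)) :
    MemLp (dataFun f) ∞ (volume : Measure (DataSpace n)) := by
  obtain ⟨C, hC⟩ : ∃ C, ∀ x, ‖f x‖ ≤ C := by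
    obtain ⟨C, -, hC⟩ := f.decay 0 0
    exact ⟨C, fun x => by simpa using hC x⟩
  have hcont : Continuous fun q : DataSpace n ×
      Metric.sphere (0 : EuclideanSpace ℝ (Fin (n + 1))) 1 =>
      f (joinLast q.1.fst 0 + ‖q.1.snd‖ • q.2.1) := by
    refine f.continuous.comp ((continuous_joinLast_zero.comp ?_).add ?_) <;> fun_prop
  refine memLp_top_of_bound (C := C) ?_ (Filter.Eventually.of_forall fun p => ?_)
  · refine StronglyMeasurable.aestronglyMeasurable ?_
    have : dataFun f = fun p : DataSpace n =>
        ∫ ω, f (joinLast p.fst 0 + ‖p.snd‖ • ω.1)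
          ∂(((volume : Measure (EuclideanSpace ℝ (Fin (n + 1)))).toSphere Set.univ)⁻¹ •
            (volume : Measure (EuclideanSpace ℝ (Fin (n + 1)))).toSphere) := by
      funext p
      simp only [dataFun, sphericalRadon, joinLast_add_smul, average]
    rw [this]
    exact hcont.stronglyMeasurable.integral_prod_right'
  · have h0 : 0 ≤ C := (norm_nonneg _).trans (hC 0)
    unfold dataFun sphericalRadon average
    refine (norm_integral_le_of_norm_le_const (C := C)
      (Filter.Eventually.of_forall fun ω => hC _)).trans ?_
    refine mul_le_of_le_one_right h0 ?_
    simp only [measureReal_def, Measure.smul_apply, smul_eq_mul]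
    exact ENNReal.toReal_le_of_le_ofReal zero_le_one (by simp)

/-- `g = Rf` as a tempered distribution on `ℝⁿ × ℝⁿ⁺¹`. -/
def dataDist {n : ℕ} (f : 𝓢(EuclideanSpace ℝ (Fin (n + 1)), ℂ)) : 𝓢'(DataSpace n, ℂ) :=
  Lp.toTemperedDistribution ((memLp_dataFun f).toLp (dataFun f))

theorem dataDist_apply {n : ℕ} (f : 𝓢(EuclideanSpace ℝ (Fin (n + 1)), ℂ))
    (φ : 𝓢(DataSpace n, ℂ)) : dataDist f φ = ∫ p, φ p * dataFun f p := by
  rw [dataDist, Lp.toTemperedDistribution_apply]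
  refine integral_congr_ae ?_
  filter_upwards [(memLp_dataFun f).coeFn_toLp] with p hp
  rw [hp, smul_eq_mul]

/-- The `j`-th coordinate of `η` as a (complex-valued) function of `(ξ, η) ∈ ℝⁿ × ℝⁿ⁺¹`. -/
def etaCoord {n : ℕ} (j : Fin (n + 1)) (p : DataSpace n) : ℂ := ((p.snd j : ℝ) : ℂ)

theorem hasTemperateGrowth_etaCoord {n : ℕ} (j : Fin (n + 1)) :
    (etaCoord j : DataSpace n → ℂ).HasTemperateGrowth :=
  (Complex.ofRealCLM ∘L EuclideanSpace.proj (𝕜 := ℝ) j ∘L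
    WithLp.sndL 2 ℝ (EuclideanSpace ℝ (Fin n))
      (EuclideanSpace ℝ (Fin (n + 1)))).hasTemperateGrowth

/-- The product `η_j T` of a tempered distribution `T` on `ℝⁿ × ℝⁿ⁺¹` with the `j`-th coordinate
of the second variable. -/
def etaMul {n : ℕ} (j : Fin (n + 1)) (T : 𝓢'(DataSpace n, ℂ)) : 𝓢'(DataSpace n, ℂ) :=
  TemperedDistribution.smulLeftCLM ℂ (etaCoord j) T

theorem etaMul_apply {n : ℕ} (j : Fin (n + 1)) (T : 𝓢'(DataSpace n, ℂ)) (φ ψ : 𝓢(DataSpace n, ℂ))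
    (h : ∀ p, ψ p = etaCoord j p * φ p) : etaMul j T φ = T ψ := by
  rw [etaMul, TemperedDistribution.smulLeftCLM_apply_apply]
  congr 1
  ext p
  rw [SchwartzMap.smulLeftCLM_apply_apply (hasTemperateGrowth_etaCoord j), h, smul_eq_mul]

end SphericalRadon

end

/-! By Fourier inversion `f` is a superposition of exponentials, so it suffices to see what the
transform does to one of them. Write `ζ ∈ ℝⁿ⁺¹` for the frequency and `ξ` for its first `n`
coordinates. The mean of `exp(i⟨ζ, ·⟩)` over the sphere of radius `‖y‖` about `(x, 0)` is `exp(i⟨ξ,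
x⟩)` times the mean over `ω ∈ Sⁿ` of `exp(i⟨‖y‖ζ, ω⟩)`. By rotation invariance only the norm of
`‖y‖ζ` matters, and `‖ζ‖y` has the same norm. The mean is therefore a superposition of the
exponentials on `ℝⁿ × ℝⁿ⁺¹` with frequencies `(ξ, ‖ζ‖ω)` (`integral_sphere_fourierChar`).

Hence `ĝ` is the push-forward under `coneMap` of `F(ζ) dζ dS(ω)` for some Schwartz `F`
(`exists_distFourier_dataDist_eq`), a finite complex measure. Since `coneMap` pulls null sets back
to null sets (`quasiMeasurePreserving_coneMap`), Radon–Nikodym gives `ĝ` an integrable density.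
Multiplication by `η_j` multiplies `F` by a function bounded by `‖ζ‖`, and `‖ζ‖F(ζ)` is still
integrable. -/

noncomputable section

namespace SphericalRadon

/-! ### Densities of push-forwards of finite complex measures. -/

section Pushforward

variable {X Y : Type*} [MeasurableSpace X] [MeasurableSpace Y] {μ : Measure X} {ν : Measure Y}
  [SigmaFinite ν]

/-- The push-forward of the finite measure with nonnegative density `(k)⁺` under a
quasi-measure-preserving map has an integrable density. -/
theorem exists_integrable_pushforward_toNNReal {Φ : X → Y}
    (hΦ : Measure.QuasiMeasurePreserving Φ μ ν) {k : X → ℝ} (hk : Integrable k μ) :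
    ∃ h : Y → ℂ, Integrable h ν ∧ ∀ φ : Y → ℂ, Measurable φ →
      ∫ x, φ (Φ x) * (((k x).toNNReal : ℝ) : ℂ) ∂μ = ∫ y, φ y * h y ∂ν := by
  have hm : AEMeasurable (fun x => (k x).toNNReal) μ := hk.aemeasurable.real_toNNReal
  set ρ : Measure X := μ.withDensity fun x => ((k x).toNNReal : ℝ≥0∞) with hρ
  have : IsFiniteMeasure ρ := isFiniteMeasure_withDensity_ofReal hk.2
  have hac : ρ.map Φ ≪ ν :=
    ((withDensity_absolutelyContinuous μ _).map hΦ.measurable).trans hΦ.absolutelyContinuous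
  refine ⟨fun y => (((ρ.map Φ).rnDeriv ν y).toReal : ℂ),
    Measure.integrable_toReal_rnDeriv.ofReal, fun φ hφ => ?_⟩
  calc ∫ x, φ (Φ x) * (((k x).toNNReal : ℝ) : ℂ) ∂μ
      = ∫ x, (k x).toNNReal • φ (Φ x) ∂μ := by
        refine integral_congr_ae (Filter.Eventually.of_forall fun x => ?_)
        simp only [NNReal.smul_def, Complex.real_smul]
        ring
    _ = ∫ x, φ (Φ x) ∂ρ := (integral_withDensity_eq_integral_smul₀ hm _).symm
    _ = ∫ y, φ y ∂(ρ.map Φ) :=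
        (integral_map hΦ.measurable.aemeasurable hφ.aestronglyMeasurable).symm
    _ = ∫ y, φ y * (((ρ.map Φ).rnDeriv ν y).toReal : ℂ) ∂ν := by
        rw [← integral_rnDeriv_smul hac]
        refine integral_congr_ae (Filter.Eventually.of_forall fun x => ?_)
        simp only [Complex.real_smul]
        ring

theorem integral_sub_add_I_mul_sub {Z : Type*} [MeasurableSpace Z] {κ : Measure Z}
    {a b c d : Z → ℂ} (ha : Integrable a κ) (hb : Integrable b κ) (hc : Integrable c κ)
    (hd : Integrable d κ) :
    ∫ z, ((a z - b z) + Complex.I * (c z - d z)) ∂κ =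
      (∫ z, a z ∂κ - ∫ z, b z ∂κ) + Complex.I * (∫ z, c z ∂κ - ∫ z, d z ∂κ) := by
  rw [integral_add (f := fun z => a z - b z) (g := fun z => Complex.I * (c z - d z))
    (ha.sub hb) ((hc.sub hd).const_mul _), integral_sub ha hb, integral_const_mul,
    integral_sub hc hd]

/-- The push-forward of a finite complex measure `k μ` under a quasi-measure-preserving map
`Φ : (X, μ) → (Y, ν)` has an integrable density with respect to `ν`. -/
theorem exists_integrable_pushforward {Φ : X → Y}
    (hΦ : Measure.QuasiMeasurePreserving Φ μ ν) {k : X → ℂ} (hk : Integrable k μ) :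
    ∃ h : Y → ℂ, Integrable h ν ∧ ∀ φ : Y → ℂ, Measurable φ → (∃ C, ∀ y, ‖φ y‖ ≤ C) →
      ∫ x, φ (Φ x) * k x ∂μ = ∫ y, φ y * h y ∂ν := by
  obtain ⟨h₁, i₁, H₁⟩ := exists_integrable_pushforward_toNNReal hΦ hk.re
  obtain ⟨h₂, i₂, H₂⟩ := exists_integrable_pushforward_toNNReal hΦ hk.re.neg
  obtain ⟨h₃, i₃, H₃⟩ := exists_integrable_pushforward_toNNReal hΦ hk.im
  obtain ⟨h₄, i₄, H₄⟩ := exists_integrable_pushforward_toNNReal hΦ hk.im.neg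
  refine ⟨fun y => (h₁ y - h₂ y) + Complex.I * (h₃ y - h₄ y),
    (i₁.sub i₂).add ((i₃.sub i₄).const_mul _), fun φ hφ ⟨C, hC⟩ => ?_⟩
  have hY : ∀ {h : Y → ℂ}, Integrable h ν → Integrable (fun y => φ y * h y) ν := fun hh =>
    hh.bdd_mul hφ.aestronglyMeasurable (Filter.Eventually.of_forall hC)
  have hX : ∀ {k : X → ℝ}, Integrable k μ →
      Integrable (fun x => φ (Φ x) * (((k x).toNNReal : ℝ) : ℂ)) μ := fun hh =>
    (hh.real_toNNReal.ofReal).bdd_mul (hφ.comp hΦ.measurable).aestronglyMeasurable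
      (Filter.Eventually.of_forall fun x => hC _)
  -- Positive and negative parts of the real and imaginary parts reduce the complex density to four
  -- nonnegative ones.
  have e : ∀ z : ℂ, z = (((z.re.toNNReal : ℝ) : ℂ) - (((-z.re).toNNReal : ℝ) : ℂ)) +
      Complex.I * ((((z.im).toNNReal : ℝ) : ℂ) - (((-z.im).toNNReal : ℝ) : ℂ)) := fun z => by
    have key : ∀ t : ℝ, (t.toNNReal : ℝ) - ((-t).toNNReal : ℝ) = t := fun t => by
      simp [max_zero_sub_max_neg_zero_eq_self]
    rw [← Complex.ofReal_sub, ← Complex.ofReal_sub, key, key, mul_comm, Complex.re_add_im]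
  have eL : ∀ x, φ (Φ x) * k x =
      (φ (Φ x) * ((((k x).re).toNNReal : ℝ) : ℂ) - φ (Φ x) * (((-(k x).re).toNNReal : ℝ) : ℂ)) +
      Complex.I * (φ (Φ x) * ((((k x).im).toNNReal : ℝ) : ℂ) -
        φ (Φ x) * (((-(k x).im).toNNReal : ℝ) : ℂ)) := fun x => by
    conv_lhs => rw [e (k x)]
    ring
  have eR : ∀ y, φ y * ((h₁ y - h₂ y) + Complex.I * (h₃ y - h₄ y)) =
      (φ y * h₁ y - φ y * h₂ y) + Complex.I * (φ y * h₃ y - φ y * h₄ y) := fun y => by ring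
  have a₁ := hX hk.re
  have a₂ := hX hk.re.neg
  have a₃ := hX hk.im
  have a₄ := hX hk.im.neg
  have b₁ := H₁ φ hφ
  have b₂ := H₂ φ hφ
  have b₃ := H₃ φ hφ
  have b₄ := H₄ φ hφ
  simp only [Pi.neg_apply, RCLike.re_to_complex, RCLike.im_to_complex] at a₁ a₂ a₃ a₄ b₁ b₂ b₃ b₄
  simp only [eL, eR]
  rw [integral_sub_add_I_mul_sub a₁ a₂ a₃ a₄,
    integral_sub_add_I_mul_sub (hY i₁) (hY i₂) (hY i₃) (hY i₄), b₁, b₂, b₃, b₄]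

end Pushforward

/-! ### Rotation invariance of the surface measure, and polar coordinates. -/

section Sphere

variable {E : Type*} [NormedAddCommGroup E] [InnerProductSpace ℝ E] [FiniteDimensional ℝ E]
  [MeasurableSpace E] [BorelSpace E]

/-- The action of a linear isometry on the unit sphere. -/
def sphereMap (A : E ≃ₗᵢ[ℝ] E) (ω : Metric.sphere (0 : E) 1) : Metric.sphere (0 : E) 1 :=
  ⟨A ω.1, by simp⟩

open scoped Pointwise in
-- The surface measure of `s` is, up to the dimension factor, the volume of the cone `(0, 1) • s`;
-- isometries preserve volume and carry cones to cones.
theorem measurePreserving_sphereMap (A : E ≃ₗᵢ[ℝ] E) :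
    MeasurePreserving (sphereMap A) (volume : Measure E).toSphere
      (volume : Measure E).toSphere := by
  have hm : Measurable (sphereMap A) :=
    (A.continuous.measurable.comp measurable_subtype_coe).subtype_mk
  refine ⟨hm, Measure.ext fun s hs => ?_⟩
  rw [Measure.map_apply hm hs, Measure.toSphere_apply' _ hs, Measure.toSphere_apply' _ (hm hs),
    ← A.measurePreserving.measure_preimage_equiv (f := A.toMeasurableEquiv)
      (Set.Ioo (0 : ℝ) 1 • (Subtype.val '' s))]
  congr 2
  ext x
  simp only [Set.mem_preimage, Set.mem_smul, Set.mem_image, Subtype.exists]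
  constructor
  · rintro ⟨r, hr, _, ⟨y, hy, hys, rfl⟩, rfl⟩
    exact ⟨r, hr, A y, ⟨A y, by simpa using hy, hys, rfl⟩, (map_smul A r y).symm⟩
  · rintro ⟨r, hr, _, ⟨y, hy, hys, rfl⟩, h⟩
    refine ⟨r, hr, A.symm y, ⟨A.symm y, by simpa using hy, ?_, rfl⟩, ?_⟩
    · simpa [sphereMap] using hys
    · rw [← map_smul, h]; exact A.symm_apply_apply x

/-- When `‖v‖ = ‖w‖`, the reflection in the hyperplane orthogonal to `v - w` carries `v` to `w` and
preserves the surface measure. -/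
theorem integral_toSphere_inner_eq_of_norm_eq (G : ℝ → ℂ) {v w : E} (h : ‖v‖ = ‖w‖) :
    ∫ ω, G ⟪v, ω.1⟫ ∂(volume : Measure E).toSphere =
      ∫ ω, G ⟪w, ω.1⟫ ∂(volume : Measure E).toSphere := by
  set A : E ≃ₗᵢ[ℝ] E := Submodule.reflection (ℝ ∙ (v - w))ᗮ
  have hA : A v = w := Submodule.reflection_sub h
  have hinj : Function.Injective (sphereMap A) := fun a b hab =>
    Subtype.ext (A.injective (congrArg Subtype.val hab))
  have hc : Continuous (sphereMap A) :=
    (A.continuous.comp continuous_subtype_val).subtype_mk _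
  have hemb : MeasurableEmbedding (sphereMap A) := hc.measurableEmbedding hinj
  rw [← (measurePreserving_sphereMap A).integral_comp hemb fun ω => G ⟪w, ω.1⟫]
  refine integral_congr_ae (Filter.Eventually.of_forall fun ω => ?_)
  simp only [sphereMap, ← hA, A.inner_map_map]

/-- Polar coordinates: a property that holds almost everywhere holds almost everywhere on almost
every sphere centred at the origin. -/
theorem ae_ae_smul_sphere {p : E → Prop} (h : ∀ᵐ x, p x) :
    ∀ᵐ r : ℝ, 0 < r → ∀ᵐ ω ∂(volume : Measure E).toSphere, p (r • ω.1) := by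
  have hpol := (volume : Measure E).measurePreserving_homeomorphUnitSphereProd
  have hsub : MeasurableEmbedding (Subtype.val : Set.Ioi (0 : ℝ) → ℝ) :=
    MeasurableEmbedding.subtype_coe measurableSet_Ioi
  have hsub' : MeasurableEmbedding (Subtype.val : ({0}ᶜ : Set E) → E) :=
    MeasurableEmbedding.subtype_coe (measurableSet_singleton _).compl
  have h₁ : ∀ᵐ x ∂((volume : Measure E).comap (Subtype.val : ({0}ᶜ : Set E) → E)), p x.1 := by
    rw [← hsub'.ae_map_iff (p := p), hsub'.map_comap]
    exact ae_restrict_of_ae h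
  have h₂ := (hpol.symm (homeomorphUnitSphereProd E).toMeasurableEquiv
    ).quasiMeasurePreserving.ae h₁
  have h₃ := Measure.ae_ae_of_ae_prod
    ((Measure.measurePreserving_swap (μ := Measure.volumeIoiPow (Module.finrank ℝ E - 1))
      (ν := (volume : Measure E).toSphere)).quasiMeasurePreserving.ae h₂)
  rw [Measure.volumeIoiPow, ae_withDensity_iff (by fun_prop)] at h₃
  have h₄ : ∀ᵐ r ∂((volume : Measure ℝ).comap (Subtype.val : Set.Ioi (0 : ℝ) → ℝ)),
      ∀ᵐ ω ∂(volume : Measure E).toSphere, p (r.1 • ω.1) := by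
    filter_upwards [h₃] with r hr
    -- The radial density `r ^ (dim E - 1)` is positive for `r > 0`, so it can be dropped from the
    -- almost-everywhere statement.
    exact hr (by simpa using pow_pos r.2 _)
  rw [← hsub.ae_map_iff (p := fun r : ℝ => ∀ᵐ ω ∂(volume : Measure E).toSphere, p (r • ω.1)),
    hsub.map_comap, Subtype.range_coe, ae_restrict_iff' measurableSet_Ioi] at h₄
  exact h₄

end Sphere

/-! ### Null sets under the radius map. -/

section NullSets

/-- The map `τ ↦ √(a² + τ²)` is nonsingular: preimages of null sets are null sets. -/
theorem ae_of_sqrt_sq_add_sq (a : ℝ) {p : ℝ → Prop} (h : ∀ᵐ r : ℝ, 0 < r → p r) :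
    ∀ᵐ τ : ℝ, p √(a ^ 2 + τ ^ 2) := by
  rw [ae_iff] at h ⊢
  set Z : Set ℝ := {r | ¬(0 < r → p r)}
  -- The preimage lies in `±ψ(W) ∪ {0}`, with `ψ` the nonnegative inverse branch. It is
  -- differentiable for `r > |a|`, so it maps null sets to null sets; the endpoint `r = |a|`
  -- corresponds to `τ = 0`.
  set ψ : ℝ → ℝ := fun r => √(r ^ 2 - a ^ 2)
  set W : Set ℝ := Z ∩ Set.Ioi |a|
  have hW : volume W = 0 := measure_mono_null Set.inter_subset_left h
  have hd : DifferentiableOn ℝ ψ W := fun r hr => by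
    have : r ^ 2 - a ^ 2 ≠ 0 := (sub_pos.2 (sq_lt_sq' (by linarith [neg_abs_le a, hr.2.out])
      (lt_of_le_of_lt (le_abs_self a) hr.2))).ne'
    exact ((by fun_prop : DifferentiableAt ℝ (fun r : ℝ => r ^ 2 - a ^ 2) r).sqrt
      this).differentiableWithinAt
  have h₁ : volume (ψ '' W) = 0 :=
    addHaar_image_eq_zero_of_differentiableOn_of_addHaar_eq_zero volume hd hW
  have h₂ : volume ((fun t : ℝ => -t) '' (ψ '' W)) = 0 :=
    addHaar_image_eq_zero_of_differentiableOn_of_addHaar_eq_zero volume (by fun_prop) h₁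
  refine measure_mono_null (t := (ψ '' W ∪ (fun t : ℝ => -t) '' (ψ '' W)) ∪ {0}) (fun τ hτ => ?_)
    (measure_union_null (measure_union_null h₁ h₂) (measure_singleton _))
  by_cases h0 : τ = 0
  · exact Or.inr h0
  have hpos : 0 < τ ^ 2 := by positivity
  have hmem : √(a ^ 2 + τ ^ 2) ∈ W := by
    refine ⟨fun H => hτ (H (Real.sqrt_pos.2 (by positivity))), ?_⟩
    rw [Set.mem_Ioi, ← Real.sqrt_sq_eq_abs]
    exact Real.sqrt_lt_sqrt (sq_nonneg a) (by linarith)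
  have hψ : ψ √(a ^ 2 + τ ^ 2) = |τ| := by
    simp only [ψ]
    rw [Real.sq_sqrt (by positivity), add_sub_cancel_left, Real.sqrt_sq_eq_abs]
  refine Or.inl ?_
  rcases abs_choice τ with h' | h'
  · exact Or.inl ⟨_, hmem, hψ.trans h'⟩
  · exact Or.inr ⟨_, ⟨_, hmem, rfl⟩, by simp [hψ, h']⟩

end NullSets

/-! ### Nonsingularity of `coneMap`. -/

section SphereParametrization

variable {n : ℕ}

/-- The map `(ζ, ω) ↦ (ξ, ‖ζ‖ω)`, where `ξ` consists of the first `n` coordinates of `ζ ∈ ℝⁿ⁺¹`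
and `ω` is a point of the unit sphere. -/
def coneMap (q : EuclideanSpace ℝ (Fin (n + 1)) ×
    Metric.sphere (0 : EuclideanSpace ℝ (Fin (n + 1))) 1) : DataSpace n :=
  WithLp.toLp 2 (firstCoords q.1, ‖q.1‖ • q.2.1)

theorem continuous_firstCoords :
    Continuous (firstCoords : EuclideanSpace ℝ (Fin (n + 1)) → EuclideanSpace ℝ (Fin n)) :=
  (PiLp.continuous_toLp 2 _).comp (by fun_prop)

theorem continuous_coneMap : Continuous (coneMap (n := n)) :=
  (WithLp.prod_continuous_toLp 2 _ _).comp
    ((continuous_firstCoords.comp continuous_fst).prodMk (by fun_prop))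

theorem norm_joinLast (x : EuclideanSpace ℝ (Fin n)) (τ : ℝ) :
    ‖joinLast x τ‖ = √(‖x‖ ^ 2 + τ ^ 2) := by
  rw [EuclideanSpace.norm_eq, EuclideanSpace.norm_sq_eq, Fin.sum_univ_castSucc]
  simp [joinLast]

theorem firstCoords_joinLast (x : EuclideanSpace ℝ (Fin n)) (τ : ℝ) :
    firstCoords (joinLast x τ) = x := by
  ext i
  simp [joinLast, firstCoords]

theorem measurePreserving_joinLast :
    MeasurePreserving (fun q : EuclideanSpace ℝ (Fin n) × ℝ => joinLast q.1 q.2) := by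
  have h₁ := (volume_preserving_piFinSuccAbove (fun _ : Fin (n + 1) => ℝ) (Fin.last n)).symm
  have h₂ := (PiLp.volume_preserving_ofLp (Fin n)).prod (MeasurePreserving.id (volume : Measure ℝ))
  have h₃ := ((PiLp.volume_preserving_toLp (Fin (n + 1))).comp h₁).comp
    ((Measure.measurePreserving_swap (μ := (volume : Measure (Fin n → ℝ)))
      (ν := (volume : Measure ℝ))).comp h₂)
  have e : (fun q : EuclideanSpace ℝ (Fin n) × ℝ => joinLast q.1 q.2) =
      (WithLp.toLp 2 ∘ (MeasurableEquiv.piFinSuccAbove (fun _ => ℝ) (Fin.last n)).symm) ∘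
        Prod.swap ∘ Prod.map WithLp.ofLp id := by
    ext q i
    refine Fin.lastCases ?_ (fun j => ?_) i <;>
      simp [joinLast, MeasurableEquiv.piFinSuccAbove]
  rw [e]
  exact h₃

/-- Write `ζ = (x, τ)`, so that `coneMap (ζ, ω) = (x, rω)` with `r = √(‖x‖² + τ²)`. For a null set
`N`, Fubini makes almost every slice `N_x` null; polar coordinates then give `rω ∉ N_x` for almost
every `ω`, for almost every `r > 0`. By `ae_of_sqrt_sq_add_sq` this holds for almost every `τ`. -/
theorem quasiMeasurePreserving_coneMap :
    Measure.QuasiMeasurePreserving (coneMap (n := n))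
      (volume.prod (volume : Measure (EuclideanSpace ℝ (Fin (n + 1)))).toSphere) volume := by
  refine ⟨continuous_coneMap.measurable, Measure.AbsolutelyContinuous.mk fun N hN h0 => ?_⟩
  have hS := continuous_coneMap.measurable hN
  have hm : MeasurableSet {ζ : EuclideanSpace ℝ (Fin (n + 1)) |
      (volume : Measure (EuclideanSpace ℝ (Fin (n + 1)))).toSphere
        (Prod.mk ζ ⁻¹' (coneMap (n := n) ⁻¹' N)) = 0} :=
    measurable_measure_prodMk_left hS (measurableSet_singleton 0)
  rw [Measure.map_apply continuous_coneMap.measurable hN, Measure.measure_prod_null hS]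
  suffices key : ∀ᵐ ζ ∂(volume.map fun q : EuclideanSpace ℝ (Fin n) × ℝ => joinLast q.1 q.2),
      (volume : Measure (EuclideanSpace ℝ (Fin (n + 1)))).toSphere
        (Prod.mk ζ ⁻¹' (coneMap (n := n) ⁻¹' N)) = 0 by
    rwa [measurePreserving_joinLast.map_eq] at key
  rw [ae_map_iff measurePreserving_joinLast.measurable.aemeasurable hm]
  refine (Measure.measure_prod_null (measurePreserving_joinLast.measurable hm).compl).2 ?_
  rw [measure_eq_zero_iff_ae_notMem] at h0
  have h₁ := Measure.ae_ae_of_ae_prod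
    ((WithLp.volume_preserving_toLp (U := EuclideanSpace ℝ (Fin n))
      (V := EuclideanSpace ℝ (Fin (n + 1)))).quasiMeasurePreserving.ae h0)
  filter_upwards [h₁] with x hx
  have h₂ := ae_of_sqrt_sq_add_sq ‖x‖ (ae_ae_smul_sphere hx)
  refine ae_iff.1 (h₂.mono fun τ hτ => ?_)
  refine measure_eq_zero_iff_ae_notMem.2 (hτ.mono fun ω hω => ?_)
  simpa [coneMap, firstCoords_joinLast, norm_joinLast] using hω

end SphereParametrization

/-! ### The Fourier transform of `Rf` as a push-forward. -/

section FourierTransformOfData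

variable {n : ℕ}

theorem eq_integral_fourier {V : Type*} [NormedAddCommGroup V] [InnerProductSpace ℝ V]
    [FiniteDimensional ℝ V] [MeasurableSpace V] [BorelSpace V] (u : 𝓢(V, ℂ)) (z : V) :
    u z = ∫ ζ, (Real.fourierChar ⟪ζ, z⟫ : ℂ) * (𝓕 u) ζ := by
  have h : 𝓕⁻ (𝓕 u) z = u z := by rw [FourierTransform.fourierInv_fourier_eq]
  rw [← h, SchwartzMap.fourierInv_coe, Real.fourierInv_eq]
  rfl

theorem integrable_fourierChar_mul {X : Type*} [MeasurableSpace X] {μ : Measure X} {g : X → ℂ}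
    (hg : Integrable g μ) {t : X → ℝ} (ht : Measurable t) :
    Integrable (fun x => (Real.fourierChar (t x) : ℂ) * g x) μ := by
  have hchar : Continuous fun t : ℝ => (Real.fourierChar t : ℂ) :=
    continuous_subtype_val.comp Real.continuous_fourierChar
  exact hg.bdd_mul (c := 1) (hchar.measurable.comp ht).aestronglyMeasurable
    (Filter.Eventually.of_forall fun x => (Circle.norm_coe _).le)

theorem inner_joinLast_zero (ζ : EuclideanSpace ℝ (Fin (n + 1))) (x : EuclideanSpace ℝ (Fin n)) :
    ⟪ζ, joinLast x 0⟫ = ⟪firstCoords ζ, x⟫ := by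
  simp [PiLp.inner_apply, Fin.sum_univ_castSucc, joinLast, firstCoords]

/-- The measure `dζ dS(ω)` on `ℝⁿ⁺¹ × Sⁿ`. -/
abbrev paramMeasure (n : ℕ) : Measure (EuclideanSpace ℝ (Fin (n + 1)) ×
    Metric.sphere (0 : EuclideanSpace ℝ (Fin (n + 1))) 1) :=
  volume.prod (volume : Measure (EuclideanSpace ℝ (Fin (n + 1)))).toSphere

instance : SFinite (paramMeasure n) := Measure.prod.instSFinite

/-- After the common factor in `p.fst` is removed, the two sides are spherical integrals attached to
`‖y‖ζ` and `‖ζ‖y`, where `y = p.snd`. These vectors have equal norm, so the integrals agree. The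
radial variable `‖y‖` is thereby traded for a character linear in `y`. -/
theorem integral_sphere_fourierChar (ζ : EuclideanSpace ℝ (Fin (n + 1))) (p : DataSpace n) :
    ∫ ω, (Real.fourierChar ⟪ζ, joinLast p.fst 0 + ‖p.snd‖ • ω.1⟫ : ℂ)
        ∂(volume : Measure (EuclideanSpace ℝ (Fin (n + 1)))).toSphere =
      ∫ ω, (Real.fourierChar ⟪coneMap (ζ, ω), p⟫ : ℂ)
        ∂(volume : Measure (EuclideanSpace ℝ (Fin (n + 1)))).toSphere := by
  have e₁ : ∀ ω : Metric.sphere (0 : EuclideanSpace ℝ (Fin (n + 1))) 1,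
      (Real.fourierChar ⟪ζ, joinLast p.fst 0 + ‖p.snd‖ • ω.1⟫ : ℂ) =
      (Real.fourierChar ⟪firstCoords ζ, p.fst⟫ : ℂ) *
        (Real.fourierChar ⟪‖p.snd‖ • ζ, ω.1⟫ : ℂ) := fun ω => by
    rw [inner_add_right, inner_joinLast_zero, AddChar.map_add_eq_mul, Circle.coe_mul,
      inner_smul_right, real_inner_smul_left]
  have e₂ : ∀ ω : Metric.sphere (0 : EuclideanSpace ℝ (Fin (n + 1))) 1,
      (Real.fourierChar ⟪coneMap (ζ, ω), p⟫ : ℂ) =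
      (Real.fourierChar ⟪firstCoords ζ, p.fst⟫ : ℂ) *
        (Real.fourierChar ⟪‖ζ‖ • p.snd, ω.1⟫ : ℂ) := fun ω => by
    have e : ⟪coneMap (ζ, ω), p⟫ = ⟪firstCoords ζ, p.fst⟫ + ⟪‖ζ‖ • p.snd, ω.1⟫ := by
      rw [real_inner_smul_left, real_inner_comm ω.1, ← real_inner_smul_left]
      exact WithLp.prod_inner_apply _ _
    rw [e, AddChar.map_add_eq_mul, Circle.coe_mul]
  simp only [e₁, e₂, integral_const_mul]
  congr 1
  refine integral_toSphere_inner_eq_of_norm_eq (fun t => (Real.fourierChar t : ℂ)) ?_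
  simp [norm_smul, mul_comm]

theorem integral_integral_fourierChar_mul {X Y : Type*} [MeasurableSpace X] [MeasurableSpace Y]
    {μ : Measure X} {σ : Measure Y} [SFinite μ] [IsFiniteMeasure σ] {g : X → ℂ}
    (hg : Integrable g μ) {s t : X × Y → ℝ} (hs : Measurable s) (ht : Measurable t)
    (h : ∀ x, ∫ y, (Real.fourierChar (s (x, y)) : ℂ) ∂σ = ∫ y, (Real.fourierChar (t (x, y)) : ℂ) ∂σ) :
    ∫ y, (∫ x, (Real.fourierChar (s (x, y)) : ℂ) * g x ∂μ) ∂σ =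
      ∫ q, (Real.fourierChar (t q) : ℂ) * g q.1 ∂(μ.prod σ) := by
  rw [← integral_integral_swap (f := fun x y => (Real.fourierChar (s (x, y)) : ℂ) * g x)
    (integrable_fourierChar_mul (hg.comp_fst σ) hs),
    integral_prod _ (integrable_fourierChar_mul (hg.comp_fst σ) ht)]
  simp only [integral_mul_const, h]

theorem integral_sphere_eq_integral_fourier (u : 𝓢(EuclideanSpace ℝ (Fin (n + 1)), ℂ))
    (p : DataSpace n) :
    ∫ ω, u (joinLast p.fst 0 + ‖p.snd‖ • ω.1)
        ∂(volume : Measure (EuclideanSpace ℝ (Fin (n + 1)))).toSphere =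
      ∫ q, (Real.fourierChar ⟪coneMap q, p⟫ : ℂ) * (𝓕 u) q.1 ∂(paramMeasure n) := by
  have hcone := continuous_coneMap (n := n)
  have hs : Measurable fun q : EuclideanSpace ℝ (Fin (n + 1)) ×
      Metric.sphere (0 : EuclideanSpace ℝ (Fin (n + 1))) 1 =>
      ⟪q.1, joinLast p.fst 0 + ‖p.snd‖ • q.2.1⟫ := by
    refine Continuous.measurable ?_
    fun_prop
  have ht : Measurable fun q : EuclideanSpace ℝ (Fin (n + 1)) ×
      Metric.sphere (0 : EuclideanSpace ℝ (Fin (n + 1))) 1 => ⟪coneMap q, p⟫ := by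
    refine Continuous.measurable ?_
    fun_prop
  rw [← integral_integral_fourierChar_mul (𝓕 u).integrable hs ht
    fun ζ => integral_sphere_fourierChar ζ p]
  simp only [← eq_integral_fourier u]

theorem dataFun_eq_integral_fourier (u : 𝓢(EuclideanSpace ℝ (Fin (n + 1)), ℂ)) (p : DataSpace n) :
    dataFun u p = ((volume : Measure (EuclideanSpace ℝ (Fin (n + 1)))).toSphere.real Set.univ)⁻¹ •
      ∫ q, (Real.fourierChar ⟪coneMap q, p⟫ : ℂ) * (𝓕 u) q.1 ∂(paramMeasure n) := by
  rw [← integral_sphere_eq_integral_fourier, ← average_eq]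
  simp only [dataFun, sphericalRadon, joinLast_add_smul]

/-- The Fourier transform of `Ru` is the push-forward of `û dζ dS` under `coneMap`, up to a constant
factor. -/
theorem integral_fourier_mul_dataFun (u : 𝓢(EuclideanSpace ℝ (Fin (n + 1)), ℂ))
    (φ : 𝓢(DataSpace n, ℂ)) :
    ∫ p, (𝓕 φ) p * dataFun u p =
      ((volume : Measure (EuclideanSpace ℝ (Fin (n + 1)))).toSphere.real Set.univ)⁻¹ •
        ∫ q, φ (coneMap q) * (𝓕 u) q.1 ∂(paramMeasure n) := by
  have hF : Integrable (fun q : EuclideanSpace ℝ (Fin (n + 1)) ×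
      Metric.sphere (0 : EuclideanSpace ℝ (Fin (n + 1))) 1 => (𝓕 u) q.1) (paramMeasure n) :=
    (𝓕 u).integrable.comp_fst _
  have hcone := continuous_coneMap (n := n)
  simp only [dataFun_eq_integral_fourier, mul_smul_comm, integral_smul]
  congr 1
  calc ∫ p, (𝓕 φ) p * ∫ q, (Real.fourierChar ⟪coneMap q, p⟫ : ℂ) * (𝓕 u) q.1 ∂(paramMeasure n)
      = ∫ p, ∫ q, (Real.fourierChar ⟪coneMap q, p⟫ : ℂ) * ((𝓕 φ) p * (𝓕 u) q.1)
          ∂(paramMeasure n) := by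
        simp only [← integral_const_mul]
        congr! 4
        ring
    _ = ∫ q, (∫ p, (Real.fourierChar ⟪coneMap q, p⟫ : ℂ) * ((𝓕 φ) p * (𝓕 u) q.1))
          ∂(paramMeasure n) := by
        have ht : Measurable fun z : DataSpace n × (EuclideanSpace ℝ (Fin (n + 1)) ×
            Metric.sphere (0 : EuclideanSpace ℝ (Fin (n + 1))) 1) => ⟪coneMap z.2, z.1⟫ := by
          refine Continuous.measurable ?_
          fun_prop
        exact integral_integral_swap
          (integrable_fourierChar_mul ((𝓕 φ).integrable.mul_prod hF) ht)
    _ = ∫ q, φ (coneMap q) * (𝓕 u) q.1 ∂(paramMeasure n) := by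
        refine integral_congr_ae (Filter.Eventually.of_forall fun q => ?_)
        simp only [← mul_assoc, integral_mul_const]
        rw [eq_integral_fourier φ (coneMap q)]
        simp only [real_inner_comm]

/-- The spherical mean commutes with dilations. This converts between the kernel `exp(-2πi⟨x, ξ⟩)`
of `𝓕` and the angular-frequency kernel of `schwartzFourier`. -/
theorem dataFun_compCLM_dilation (f : 𝓢(EuclideanSpace ℝ (Fin (n + 1)), ℂ)) (p : DataSpace n) :
    dataFun (SchwartzMap.compCLMOfContinuousLinearEquiv ℂ (dilation _).symm f)
      ((2 * Real.pi)⁻¹ • p) = dataFun f p := by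
  have hpi : (2 * Real.pi) ≠ 0 := Real.two_pi_pos.ne'
  have hj : ∀ (c : ℝ) (x : EuclideanSpace ℝ (Fin n)), joinLast (c • x) 0 = c • joinLast x 0 := by
    intro c x
    ext i
    refine Fin.lastCases ?_ (fun j => ?_) i <;> simp [joinLast]
  have hd : ∀ z : EuclideanSpace ℝ (Fin (n + 1)),
      (dilation (EuclideanSpace ℝ (Fin (n + 1)))).symm ((2 * Real.pi)⁻¹ • z) = z := fun z =>
    (dilation (EuclideanSpace ℝ (Fin (n + 1)))).symm_apply_apply z
  simp only [dataFun, sphericalRadon, joinLast_add_smul]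
  congr 1
  ext ω
  have e : joinLast ((2 * Real.pi)⁻¹ • p).fst 0 + ‖((2 * Real.pi)⁻¹ • p).snd‖ • ω.1 =
      (2 * Real.pi)⁻¹ • (joinLast p.fst 0 + ‖p.snd‖ • ω.1) := by
    rw [WithLp.smul_fst, WithLp.smul_snd, norm_smul, hj, smul_add, smul_smul, Real.norm_of_nonneg
      (inv_nonneg.2 Real.two_pi_pos.le)]
  rw [e, SchwartzMap.compCLMOfContinuousLinearEquiv_apply, Function.comp_apply, hd]

/-- The Fourier transform of `Rf` as a push-forward of a measure with Schwartz density. -/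
theorem exists_distFourier_dataDist_eq (f : 𝓢(EuclideanSpace ℝ (Fin (n + 1)), ℂ)) :
    ∃ F : 𝓢(EuclideanSpace ℝ (Fin (n + 1)), ℂ), ∀ φ : 𝓢(DataSpace n, ℂ),
      distFourier (dataDist f) φ = ∫ q, φ (coneMap q) * F q.1 ∂(paramMeasure n) := by
  set u := SchwartzMap.compCLMOfContinuousLinearEquiv ℂ (dilation _).symm f with hu
  -- `a` is the unitary normalization, `b` the Jacobian of the substitution `p ↦ (2π)⁻¹p`, and `c`
  -- the reciprocal of the total mass of the sphere.
  set a : ℂ := (((2 * Real.pi) ^ (-(Module.finrank ℝ (DataSpace n) : ℝ) / 2) : ℝ) : ℂ)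
  set b : ℝ := |((2 * Real.pi)⁻¹ ^ Module.finrank ℝ (DataSpace n))⁻¹|
  set c : ℝ := ((volume : Measure (EuclideanSpace ℝ (Fin (n + 1)))).toSphere.real Set.univ)⁻¹
  refine ⟨(a * b * c) • 𝓕 u, fun φ => ?_⟩
  rw [distFourier_apply, dataDist_apply]
  calc ∫ p, schwartzFourier (DataSpace n) φ p * dataFun f p
      = ∫ p, a * ((𝓕 φ) ((2 * Real.pi)⁻¹ • p) * dataFun u ((2 * Real.pi)⁻¹ • p)) := by
        refine integral_congr_ae (Filter.Eventually.of_forall fun p => ?_)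
        simp only [hu, dataFun_compCLM_dilation]
        rw [← mul_assoc]
        rfl
    _ = a * (b • (c • ∫ q, φ (coneMap q) * (𝓕 u) q.1 ∂(paramMeasure n))) := by
        rw [integral_const_mul, ← integral_fourier_mul_dataFun]
        congr 1
        exact Measure.integral_comp_smul volume (fun p => (𝓕 φ) p * dataFun u p) _
    _ = ∫ q, φ (coneMap q) * ((a * b * c) • 𝓕 u) q.1 ∂(paramMeasure n) := by
        simp only [smul_apply, smul_eq_mul, mul_left_comm (φ _), integral_const_mul,
          Complex.real_smul]
        ring

/-- Schwartz functions are bounded and measurable, so they are admissible test functions for the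
push-forward density of `k`. -/
theorem isL1_of_eq_integral_coneMap {T : 𝓢'(DataSpace n, ℂ)}
    {k : EuclideanSpace ℝ (Fin (n + 1)) ×
      Metric.sphere (0 : EuclideanSpace ℝ (Fin (n + 1))) 1 → ℂ}
    (hk : Integrable k (paramMeasure n))
    (hT : ∀ φ : 𝓢(DataSpace n, ℂ), T φ = ∫ q, φ (coneMap q) * k q ∂(paramMeasure n)) :
    IsL1 T := by
  obtain ⟨h, hi, H⟩ := exists_integrable_pushforward quasiMeasurePreserving_coneMap hk
  refine ⟨(memLp_one_iff_integrable.2 hi).toLp h, ?_⟩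
  ext φ
  rw [Lp.toTemperedDistribution_apply, hT, H φ φ.continuous.measurable]
  · refine integral_congr_ae ?_
    filter_upwards [(memLp_one_iff_integrable.2 hi).coeFn_toLp] with p hp
    rw [hp, smul_eq_mul]
  · obtain ⟨C, -, hC⟩ := φ.decay 0 0
    exact ⟨C, fun x => by simpa using hC x⟩

/-- The second component of `coneMap (ζ, ω)` has norm `‖ζ‖`, so the integrand is dominated by `‖ζ‖
‖F ζ‖`, which is integrable because `F` is Schwartz and the sphere has finite measure. -/
theorem integrable_etaCoord_coneMap_mul (j : Fin (n + 1))
    (F : 𝓢(EuclideanSpace ℝ (Fin (n + 1)), ℂ)) :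
    Integrable (fun q => etaCoord j (coneMap q) * F q.1) (paramMeasure n) := by
  have h : Integrable (fun q : EuclideanSpace ℝ (Fin (n + 1)) ×
      Metric.sphere (0 : EuclideanSpace ℝ (Fin (n + 1))) 1 => ‖q.1‖ ^ 1 * ‖F q.1‖)
      (paramMeasure n) := (F.integrable_pow_mul volume 1).comp_fst _
  have hη : Continuous (etaCoord (n := n) j) := (hasTemperateGrowth_etaCoord j).1.continuous
  refine h.mono' (((hη.comp continuous_coneMap).mul
    (F.continuous.comp continuous_fst)).aestronglyMeasurable)
    (Filter.Eventually.of_forall fun q => ?_)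
  rw [norm_mul, pow_one]
  gcongr
  have h₁ : ‖etaCoord j (coneMap q)‖ ≤ ‖(coneMap q).snd‖ := by
    rw [etaCoord, Complex.norm_real]
    exact PiLp.norm_apply_le _ j
  refine h₁.trans_eq ?_
  simp [coneMap, norm_smul]

end FourierTransformOfData

end SphericalRadon

end

theorem mainTheorem10 (n : ℕ) (hn : 1 ≤ n)
    (f : 𝓢(EuclideanSpace ℝ (Fin (n + 1)), ℂ)) (hf : SphericalRadon.EvenInLast f) :
    SphericalRadon.IsL1 (SphericalRadon.distFourier (SphericalRadon.dataDist f)) ∧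
      ∀ j : Fin (n + 1),
        SphericalRadon.IsL1 (SphericalRadon.etaMul j
          (SphericalRadon.distFourier (SphericalRadon.dataDist f))) := by
  open SphericalRadon in
  obtain ⟨F, hF⟩ := exists_distFourier_dataDist_eq f
  refine ⟨isL1_of_eq_integral_coneMap (F.integrable.comp_fst _) hF, fun j =>
    isL1_of_eq_integral_coneMap (integrable_etaCoord_coneMap_mul j F) fun φ => ?_⟩
  have hψ : ∀ p, SchwartzMap.smulLeftCLM ℂ (etaCoord j) φ p = etaCoord j p * φ p := fun p => by
    rw [SchwartzMap.smulLeftCLM_apply_apply (hasTemperateGrowth_etaCoord j), smul_eq_mul]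
  rw [etaMul_apply j _ φ _ hψ, hF]
  refine integral_congr_ae (Filter.Eventually.of_forall fun q => ?_)
  simp only [hψ]
  ring
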